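/- Let $n\ge 2$ and let $\Sigma$ be an alphabet with $q$ elements. For $u=(u_0,\dots,u_{n-1})$ and $v=(v_0,\dots,v_{n-1})$ in $\Sigma^n$, with indices taken modulo $n$, the pair-distance is $$D_{\mathrm p}(u,v)=\bigl|\{\,i\in\mathbb Z/n\mathbb Z : (u_i,u_{i+1})\neq (v_i,v_{i+1})\,\}\bigr| .$$ A code $C\subseteq\Sigma^n$ with at least two codewords has pair-distance $d$ if $d=\min\{D_{\mathrm p}(u,v): u,v\in C,\ u\ne v\}$; it is then called an $(n,d)_q$-symbol-pair code. Such a code is called MDS if $|C|=q^{\,n-d+2}$. For $2\le d\le n$ let $$q(n,d)=\min\{\,q_0 : \text{an MDS } (n,d)_q\text{-symbol-pair code exists for every integer } q\ge q_0\,\}.$$ Theorem. In each of the following cases the minimum $q(n,d)$ exists, and (i) $q(n,d)=2$ whenever $2\le d\le 4$ and $n\ge d$, and $q(n,n)=2$ for every $n\ge 2$; (ii) $q(6,5)=q(7,6)=2$ and $q(8,7)=3$; (iii) $q(n,n-2)=2$ for $7\le n\le 10$. -/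

import Mathlib

/-- The symbol-pair read vector of `u`: the coordinates are the cyclically consecutive pairs
`(u₀, u₁), (u₁, u₂), …, (uₙ₋₂, uₙ₋₁), (uₙ₋₁, u₀)`; `finRotate n` is `i ↦ i + 1` modulo `n`. -/
def pairRead {n : ℕ} {S : Type*} (u : Fin n → S) : Fin n → S × S :=
  fun i => (u i, u (finRotate n i))

theorem pairRead_succ_apply {n : ℕ} {S : Type*} (u : Fin (n + 1) → S) (i : Fin (n + 1)) :
    pairRead u i = (u i, u (i + 1)) := by
  simp [pairRead]

/-- The pair-distance: the Hamming distance between the symbol-pair read vectors. -/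
def pairDist {n : ℕ} {S : Type*} [DecidableEq S] (u v : Fin n → S) : ℕ :=
  hammingDist (pairRead u) (pairRead v)

/-- `C` has pair-distance `d`: the minimum of the pair-distances between distinct codewords
exists and is equal to `d`. A code with at most one codeword has no pair-distance. -/
def HasPairDistance {n : ℕ} {S : Type*} [DecidableEq S] (C : Finset (Fin n → S)) (d : ℕ) : Prop :=
  IsLeast {m : ℕ | ∃ u ∈ C, ∃ v ∈ C, u ≠ v ∧ pairDist u v = m} d

/-- `C` is an MDS `(n, d)_q`-symbol-pair code, `q` being the size of the alphabet `S`: it has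
pair-distance `d` and `q ^ (n - d + 2)` codewords. A pair-distance is at most `n`, so the
subtraction does not truncate. -/
def IsMDSSymbolPairCode {n : ℕ} {S : Type*} [Fintype S] [DecidableEq S]
    (C : Finset (Fin n → S)) (d : ℕ) : Prop :=
  HasPairDistance C d ∧ C.card = Fintype.card S ^ (n - d + 2)

/-- There is an MDS `(n, d)_q`-symbol-pair code. -/
def ExistsMDSSymbolPairCode (n d q : ℕ) : Prop :=
  ∃ C : Finset (Fin n → Fin q), IsMDSSymbolPairCode C d

/-- `q(n, d) = q₁`: the least `q₀` such that an MDS `(n, d)_q`-symbol-pair code exists for all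
`q ≥ q₀` exists and is equal to `q₁`. -/
def MDSThresholdEq (n d q₁ : ℕ) : Prop :=
  IsLeast {q₀ : ℕ | ∀ q : ℕ, q₀ ≤ q → ExistsMDSSymbolPairCode n d q} q₁

/-!
By the pigeonhole principle a code with `q ^ (n - d + 2)` words has two distinct words that agree
in the first `n - d + 1` letters, so its pair-distance is at most `d`
(`isMDSSymbolPairCode_of_le`). For existence it is therefore enough to have a code of that size
whose distinct words agree in at most `n - d` read pairs. The one-letter alphabet never has a
code, so a threshold `2` amounts to a code for every `q ≥ 2`.

* For `d = 2, 3, 4` the code is the kernel over `ℤ / q` of the zero map, of the sum of the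
  coordinates, and of two checks whose cyclically adjacent columns have determinant `±1`. For
  `d = 4` a nonzero word of pair-weight below four is supported on two adjacent positions
  (`four_le_pairDist_zero`), which such checks exclude. The same columns, read as rows of a
  generator matrix, settle `d = n`.
* For `(6, 5)`, `(7, 6)` and `(n, n - 2)` there is one integer generator matrix with `k` columns,
  `k = n - d + 2`, good modulo every `q`: the rows met by any `k - 1` read pairs contain a minor
  `±1` (`existsMDS_of_intGenerator`).
* For `(8, 7)` a generator matrix works over every finite ring in which some `ω` and `ω - 1` are
  both units (`octagon_spans`). Such rings (`ℤ / m` with `m` odd and `ω = 2`, the field with four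
  elements, and products of these) have all orders `m * 4 ^ a` with `m` odd. Each remaining
  `q ≥ 3` is twice such an order, and there a nonlinear twist combines the octagon over the ring
  with a binary octagon that has a single collision (`existsMDS_doubledOctagon`). For `q = 2`
  counting agreements gives a contradiction (`not_existsMDS_eight_seven_two`).
-/

/-! ### Agreements, and the pair-distance of a code of MDS size -/

/-- The pair-distance and the number of agreeing coordinates of the read vectors add up to `n`. -/
theorem card_agree_add_pairDist {n : ℕ} {S : Type*} [DecidableEq S] (u v : Fin n → S) :
    (Finset.univ.filter fun i => pairRead u i = pairRead v i).card + pairDist u v = n := by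
  have h := Finset.card_filter_add_card_filter_not (s := (Finset.univ : Finset (Fin n)))
    (fun i => pairRead u i = pairRead v i)
  rw [Finset.card_univ, Fintype.card_fin] at h
  exact h

theorem pairDist_self {n : ℕ} {S : Type*} [DecidableEq S] (u : Fin n → S) : pairDist u u = 0 :=
  hammingDist_self _

theorem pairDist_sub {n : ℕ} {S : Type*} [DecidableEq S] [AddGroup S] (u v : Fin n → S) :
    pairDist (u - v) 0 = pairDist u v := by
  simp only [pairDist, hammingDist, pairRead, Pi.sub_apply, Pi.zero_apply, ne_eq, Prod.mk.injEq,
    sub_eq_zero]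

theorem pairDist_comp_equiv {n : ℕ} {S S' : Type*} [DecidableEq S] [DecidableEq S'] (e : S ≃ S')
    (u v : Fin n → S) : pairDist (e ∘ u) (e ∘ v) = pairDist u v := by
  simp [pairDist, hammingDist, pairRead]

/-- Two words that agree in the coordinates `0, …, m` agree in the first `m` read pairs. -/
theorem pairDist_add_le_of_agree {n m : ℕ} (hm : m < n) {S : Type*} [DecidableEq S]
    {u v : Fin n → S} (h : ∀ i : Fin n, i.1 ≤ m → u i = v i) : pairDist u v + m ≤ n := by
  have hc := card_agree_add_pairDist u v
  obtain ⟨n, rfl⟩ : ∃ n', n = n' + 1 := ⟨n - 1, by omega⟩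
  have hsub : (Finset.univ.filter fun i : Fin (n + 1) => i.1 < m) ⊆
      Finset.univ.filter fun i => pairRead u i = pairRead v i := by
    intro i hi
    simp only [Finset.mem_filter, Finset.mem_univ, true_and] at hi ⊢
    have h1 : (i + 1).1 ≤ m := by
      rw [Fin.val_add_one_of_lt (Fin.lt_def.2 (by simp; omega))]
      omega
    rw [pairRead_succ_apply, pairRead_succ_apply, h i hi.le, h _ h1]
  have h2 := Finset.card_le_card hsub
  rw [Fin.card_filter_val_lt, min_eq_right hm.le] at h2
  omega

/-- The Singleton bound makes the pair-distance of a code of MDS size at most `d`: by the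
pigeonhole principle two codewords agree in the first `n - d + 1` coordinates. Hence it is enough
that distinct codewords are at pair-distance at least `d`. -/
theorem isMDSSymbolPairCode_of_le {n d : ℕ} (hd : 1 ≤ d) (hdn : d ≤ n) {S : Type*} [Fintype S]
    [DecidableEq S] (hS : 2 ≤ Fintype.card S) (C : Finset (Fin n → S))
    (hC : C.card = Fintype.card S ^ (n - d + 2))
    (h : ∀ u ∈ C, ∀ v ∈ C, u ≠ v → d ≤ pairDist u v) : IsMDSSymbolPairCode C d := by
  refine ⟨⟨?_, ?_⟩, hC⟩
  · let ρ : (Fin n → S) → (Fin (n - d + 1) → S) := fun u i => u ⟨i.1, by omega⟩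
    have hlt : (Finset.univ : Finset (Fin (n - d + 1) → S)).card < C.card := by
      rw [hC, Finset.card_univ, Fintype.card_fun, Fintype.card_fin]
      exact Nat.pow_lt_pow_right (by omega) (by omega)
    obtain ⟨u, hu, v, hv, huv, he⟩ := Finset.exists_ne_map_eq_of_card_lt_of_maps_to hlt
      (f := ρ) (fun _ _ => Finset.mem_coe.2 (Finset.mem_univ _))
    refine ⟨u, hu, v, hv, huv, le_antisymm ?_ (h u hu v hv huv)⟩
    have := pairDist_add_le_of_agree (m := n - d) (u := u) (v := v) (by omega)
      (fun i hi => congrFun he ⟨i.1, by omega⟩)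
    omega
  · rintro m ⟨u, hu, v, hv, huv, rfl⟩
    exact h u hu v hv huv

/-- A code may be given by an encoder `E` of `q ^ (n - d + 2)` messages, over any alphabet of
size `q`. -/
theorem existsMDS_of_encoder {n d : ℕ} (hd : 1 ≤ d) (hdn : d ≤ n) {X S : Type*} [Fintype X]
    [Fintype S] [DecidableEq S] (hS : 2 ≤ Fintype.card S) (E : X → Fin n → S)
    (hX : Fintype.card X = Fintype.card S ^ (n - d + 2))
    (hE : ∀ x y, x ≠ y → d ≤ pairDist (E x) (E y)) :
    ExistsMDSSymbolPairCode n d (Fintype.card S) := by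
  classical
  let e : S ≃ Fin (Fintype.card S) := Fintype.equivFin S
  let F : X → Fin n → Fin (Fintype.card S) := fun x => e ∘ E x
  have hF : ∀ x y, x ≠ y → d ≤ pairDist (F x) (F y) := fun x y hxy => by
    rw [pairDist_comp_equiv]
    exact hE x y hxy
  have hinj : Function.Injective F := by
    intro x y hxy
    by_contra hne
    have := hF x y hne
    rw [hxy, pairDist_self] at this
    omega
  refine ⟨Finset.univ.image F, isMDSSymbolPairCode_of_le hd hdn (by simpa using hS) _ ?_ ?_⟩
  · rw [Finset.card_image_of_injective _ hinj, Finset.card_univ, hX, Fintype.card_fin]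
  · intro u hu v hv huv
    obtain ⟨x, -, rfl⟩ := Finset.mem_image.1 hu
    obtain ⟨y, -, rfl⟩ := Finset.mem_image.1 hv
    exact hF x y fun hxy => huv (by rw [hxy])

/-- Over an alphabet with one letter there is only one word, so no code has a pair-distance. -/
theorem not_existsMDS_one (n d : ℕ) : ¬ ExistsMDSSymbolPairCode n d 1 := by
  rintro ⟨C, ⟨⟨u, -, v, -, huv, -⟩, -⟩, -⟩
  exact huv (Subsingleton.elim u v)

theorem mdsThresholdEq_two {n d : ℕ} (h : ∀ q, 2 ≤ q → ExistsMDSSymbolPairCode n d q) :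
    MDSThresholdEq n d 2 := by
  refine ⟨h, fun q₀ hq₀ => ?_⟩
  by_contra hlt
  exact not_existsMDS_one n d (hq₀ 1 (by omega))

/-! ### Codes given by a generator matrix -/

/-- If fewer than `d` read pairs of two words differ, at least `n - d + 1` agree. -/
theorem exists_agree_of_pairDist_lt {n d k : ℕ} (hdn : d ≤ n) (hk : n + 2 = d + k)
    {S : Type*} [DecidableEq S] {u v : Fin n → S} (h : pairDist u v < d) :
    ∃ T : Finset (Fin n), T.card + 1 = k ∧
      ∀ i ∈ T, u i = v i ∧ u (finRotate n i) = v (finRotate n i) := by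
  have hc := card_agree_add_pairDist u v
  obtain ⟨T, hT, hTc⟩ := Finset.exists_subset_card_eq
    (s := Finset.univ.filter fun i => pairRead u i = pairRead v i) (n := k - 1) (by omega)
  have hlt := Finset.card_le_card hT
  rw [hTc] at hlt
  refine ⟨T, by omega, fun i hi => ?_⟩
  have := (Finset.mem_filter.1 (hT hi)).2
  simpa [pairRead] using this

/-- The code generated by an `n × k` matrix is MDS if `k - 1` read pairs vanish only on the zero
message. -/
theorem existsMDS_of_generator {n d k : ℕ} (hd : 1 ≤ d) (hdn : d ≤ n) (hk : n + 2 = d + k)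
    {R : Type*} [CommRing R] [Fintype R] (hR : 2 ≤ Fintype.card R) (G : Matrix (Fin n) (Fin k) R)
    (hG : ∀ T : Finset (Fin n), T.card + 1 = k → ∀ x : Fin k → R,
      (∀ i ∈ T, G.mulVec x i = 0 ∧ G.mulVec x (finRotate n i) = 0) → x = 0) :
    ExistsMDSSymbolPairCode n d (Fintype.card R) := by
  classical
  refine existsMDS_of_encoder hd hdn hR (fun x => G.mulVec x) ?_ ?_
  · rw [Fintype.card_fun, Fintype.card_fin]
    congr 1
    omega
  · intro x y hxy
    by_contra hlt
    obtain ⟨T, hT, h⟩ := exists_agree_of_pairDist_lt hdn hk (not_le.1 hlt)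
    refine hxy (sub_eq_zero.1 (hG T hT (x - y) fun i hi => ?_))
    simp only [Matrix.mulVec_sub, Pi.sub_apply, sub_eq_zero]
    exact h i hi

theorem eq_zero_of_natAbs_det_eq_one {n k : ℕ} (G : Matrix (Fin n) (Fin k) ℤ) (f : Fin k → Fin n)
    (hdet : (G.submatrix f id).det.natAbs = 1) {R : Type*} [CommRing R] (x : Fin k → R)
    (hx : ∀ a, (G.map (Int.cast : ℤ → R)).mulVec x (f a) = 0) : x = 0 := by
  have hu : IsUnit (((G.submatrix f id).map (Int.castRingHom R)) : Matrix (Fin k) (Fin k) R) := by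
    have h1 : IsUnit (G.submatrix f id) :=
      (Matrix.isUnit_iff_isUnit_det _).2 (Int.isUnit_iff_natAbs_eq.2 hdet)
    exact h1.map (Int.castRingHom R).mapMatrix
  refine Matrix.mulVec_injective_of_isUnit hu ?_
  rw [Matrix.mulVec_zero]
  funext a
  exact hx a

/-- An integer matrix generates an MDS code modulo every `q ≥ 2` if, for each choice `l` of
`k - 1` read pairs, the rows that occur in them contain a `k × k` minor equal to `±1`. The
condition is a finite computation. -/
theorem existsMDS_of_intGenerator {n d k : ℕ} [NeZero n] (hd : 1 ≤ d) (hdn : d ≤ n)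
    (hk : n + 2 = d + k) (G : Matrix (Fin n) (Fin k) ℤ)
    (hG : ∀ l ∈ List.sublistsLen (k - 1) (List.finRange n),
      ∃ f ∈ List.sublistsLen k (l ++ l.map (finRotate n)),
        (G.submatrix (fun a : Fin k => f.getD a.1 0) id).det.natAbs = 1)
    (q : ℕ) (hq : 2 ≤ q) : ExistsMDSSymbolPairCode n d q := by
  have : NeZero q := ⟨by omega⟩
  rw [← ZMod.card q] at hq ⊢
  refine existsMDS_of_generator hd hdn hk hq (G.map (Int.cast : ℤ → ZMod q)) ?_
  intro T hT x hx
  have hl : (List.finRange n).filter (· ∈ T) ∈ List.sublistsLen (k - 1) (List.finRange n) := by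
    refine List.mem_sublistsLen.2 ⟨List.filter_sublist, ?_⟩
    have h1 : ((List.finRange n).filter (· ∈ T)).toFinset = T := by
      ext i
      simp
    rw [← List.toFinset_card_of_nodup ((List.nodup_finRange n).filter _), h1]
    omega
  obtain ⟨f, hf, hdet⟩ := hG _ hl
  obtain ⟨hsub, hlen⟩ := List.mem_sublistsLen.1 hf
  refine eq_zero_of_natAbs_det_eq_one G _ hdet x fun a => ?_
  have hmem : f.getD a.1 0 ∈ f := by
    rw [List.getD_eq_getElem _ _ (by omega)]
    exact List.getElem_mem _
  have hmem' := hsub.subset hmem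
  simp only [List.mem_append, List.mem_map, List.mem_filter, List.mem_finRange, true_and,
    decide_eq_true_eq] at hmem'
  rcases hmem' with h | ⟨i, hi, h⟩
  · exact (hx _ h).1
  · rw [← h]
    exact (hx _ hi).2

/-! ### The values `q(6, 5)`, `q(7, 6)` and `q(n, n - 2)` -/

set_option maxRecDepth 10000 in
theorem existsMDS_six_five (q : ℕ) (hq : 2 ≤ q) : ExistsMDSSymbolPairCode 6 5 q :=
  existsMDS_of_intGenerator (k := 3) (by norm_num) (by norm_num) rfl
    !![1, 0, 0; 0, 1, 0; 0, 0, 1; 1, 1, 1; 1, 0, 1; 0, 1, 1]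
    (by decide +kernel) q hq

set_option maxRecDepth 10000 in
theorem existsMDS_seven_six (q : ℕ) (hq : 2 ≤ q) : ExistsMDSSymbolPairCode 7 6 q :=
  existsMDS_of_intGenerator (k := 3) (by norm_num) (by norm_num) rfl
    !![1, 0, 0; 0, 1, 0; 0, 0, 1; 1, 1, 0; 0, 1, 1; 1, 1, 1; 1, 0, 1]
    (by decide +kernel) q hq

set_option maxRecDepth 10000 in
theorem existsMDS_seven_five (q : ℕ) (hq : 2 ≤ q) : ExistsMDSSymbolPairCode 7 5 q :=
  existsMDS_of_intGenerator (k := 4) (by norm_num) (by norm_num) rfl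
    !![1, 0, 0, 0; 0, 1, 0, 0; 0, 0, 1, 0; 0, 0, 0, 1; 1, 1, -1, 0; 0, 1, -1, -1; 1, -1, 0, 1]
    (by decide +kernel) q hq

set_option maxRecDepth 10000 in
theorem existsMDS_eight_six (q : ℕ) (hq : 2 ≤ q) : ExistsMDSSymbolPairCode 8 6 q :=
  existsMDS_of_intGenerator (k := 4) (by norm_num) (by norm_num) rfl
    !![1, 0, 0, 0; 0, 1, 0, 0; 0, 0, 1, 0; 0, 0, 0, 1; 1, 0, -1, 0; 0, 1, 1, 1; 1, 1, 1, 0;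
      0, 1, 0, 1]
    (by decide +kernel) q hq

set_option maxRecDepth 10000 in
theorem existsMDS_nine_seven (q : ℕ) (hq : 2 ≤ q) : ExistsMDSSymbolPairCode 9 7 q :=
  existsMDS_of_intGenerator (k := 4) (by norm_num) (by norm_num) rfl
    !![1, 0, 0, 0; 0, 1, 0, 0; 0, 0, 1, 0; 0, 0, 0, 1; 1, 0, -1, 0; 1, 1, 1, 1; 1, 0, 0, 1;
      1, 1, -1, 0; 1, 1, 0, 1]
    (by decide +kernel) q hq

set_option maxRecDepth 10000 in
theorem existsMDS_ten_eight (q : ℕ) (hq : 2 ≤ q) : ExistsMDSSymbolPairCode 10 8 q :=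
  existsMDS_of_intGenerator (k := 4) (by norm_num) (by norm_num) rfl
    !![1, 0, 0, 0; 0, 1, 0, 0; 0, 0, 1, 0; 0, 0, 0, 1; 1, 0, -1, 0; 1, -1, 0, -1; 1, -1, 1, 0;
      0, 1, 0, 1; 1, 0, 0, -1; 1, 1, 1, 1]
    (by decide +kernel) q hq

/-! ### The value `q(n, n)` -/

/-- The first coordinate of the columns `(1, 0), (0, 1), (1, 0), (0, 1), …`, closed up by `(1, 1)`
in the last place when the length is odd. Cyclically adjacent columns have determinant `±1`. -/
def altFst (R : Type*) [Zero R] [One R] (n : ℕ) (i : Fin n) : R :=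
  if i.1 % 2 = 0 then 1 else 0

/-- The second coordinate of the columns described at `altFst`. -/
def altSnd (R : Type*) [Zero R] [One R] (n : ℕ) (i : Fin n) : R :=
  if i.1 % 2 = 1 ∨ i.1 + 1 = n then 1 else 0

theorem val_finRotate {n : ℕ} (i : Fin n) :
    (finRotate n i).1 = if i.1 + 1 = n then 0 else i.1 + 1 := by
  obtain ⟨n, rfl⟩ : ∃ n', n = n' + 1 := ⟨n - 1, by have := i.2; omega⟩
  rw [coe_finRotate]
  simp [Fin.ext_iff]

theorem altFst_altSnd_rows {R : Type*} [CommRing R] {n : ℕ} (hn : 2 ≤ n) (i : Fin n) {a b : R}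
    (h₁ : altFst R n i * a + altSnd R n i * b = 0)
    (h₂ : altFst R n (finRotate n i) * a + altSnd R n (finRotate n i) * b = 0) :
    a = 0 ∧ b = 0 := by
  have hi := i.2
  simp only [altFst, altSnd, val_finRotate] at h₁ h₂
  split_ifs at h₁ h₂ <;> first | omega | (constructor <;> grind)

theorem altFst_altSnd_columns {R : Type*} [CommRing R] {n : ℕ} (hn : 2 ≤ n) (i : Fin n) {a b : R}
    (h₁ : altFst R n i * a + altFst R n (finRotate n i) * b = 0)
    (h₂ : altSnd R n i * a + altSnd R n (finRotate n i) * b = 0) :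
    a = 0 ∧ b = 0 := by
  have hi := i.2
  simp only [altFst, altSnd, val_finRotate] at h₁ h₂
  split_ifs at h₁ h₂ <;> first | omega | (constructor <;> grind)

theorem existsMDS_self {n : ℕ} (hn : 2 ≤ n) (q : ℕ) (hq : 2 ≤ q) :
    ExistsMDSSymbolPairCode n n q := by
  have : NeZero q := ⟨by omega⟩
  rw [← ZMod.card q] at hq ⊢
  refine existsMDS_of_generator (k := 2) (by omega) le_rfl rfl hq
    (Matrix.of fun i => ![altFst (ZMod q) n i, altSnd (ZMod q) n i]) ?_
  intro T hT x hx
  obtain ⟨i, rfl⟩ := Finset.card_eq_one.1 (by omega : T.card = 1)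
  have h := hx i (Finset.mem_singleton_self i)
  simp only [Matrix.mulVec, dotProduct, Fin.sum_univ_two, Matrix.of_apply, Matrix.cons_val_zero,
    Matrix.cons_val_one] at h
  obtain ⟨h0, h1⟩ := altFst_altSnd_rows hn i h.1 h.2
  funext j
  fin_cases j
  · exact h0
  · exact h1

/-! ### The values `q(n, 2)`, `q(n, 3)` and `q(n, 4)` -/

/-- The kernel of a surjection of `R ^ n` onto a group with `|R| ^ (d - 2)` elements is an MDS code
if its nonzero words have pair-weight at least `d`. -/
theorem existsMDS_of_check {n d : ℕ} (hd : 2 ≤ d) (hdn : d ≤ n) {R M : Type*} [AddCommGroup R]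
    [Fintype R] [DecidableEq R] [AddCommGroup M] (hR : 2 ≤ Fintype.card R)
    (φ : (Fin n → R) →+ M) (hφ : Function.Surjective φ)
    (hM : Nat.card M = Fintype.card R ^ (d - 2))
    (hw : ∀ w, φ w = 0 → w ≠ 0 → d ≤ pairDist w 0) :
    ExistsMDSSymbolPairCode n d (Fintype.card R) := by
  classical
  have hcard := φ.ker.card_mul_index
  rw [AddSubgroup.index_ker, AddMonoidHom.range_eq_top.2 hφ, AddSubgroup.card_top, hM,
    Nat.card_eq_fintype_card, Nat.card_eq_fintype_card, Fintype.card_fun, Fintype.card_fin] at hcard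
  refine existsMDS_of_encoder (X := φ.ker) (by omega) hdn hR (fun x => x.1) ?_ ?_
  · refine Nat.eq_of_mul_eq_mul_right (pow_pos (by omega : 0 < Fintype.card R) (d - 2)) ?_
    rw [hcard, ← pow_add]
    congr 1
    omega
  · intro x y hxy
    rw [← pairDist_sub]
    refine hw _ ?_ fun h => hxy (Subtype.ext (sub_eq_zero.1 h))
    rw [map_sub, φ.mem_ker.1 x.2, φ.mem_ker.1 y.2, sub_zero]

/-- The pair-weight counts the positions `i` for which `i` or `i + 1` lies in the support. -/
theorem pairDist_zero_eq_card {n : ℕ} {R : Type*} [DecidableEq R] [Zero R] (w : Fin (n + 1) → R) :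
    pairDist w 0 = ((Finset.univ.filter fun i => w i ≠ 0) ∪
      (Finset.univ.filter fun i => w i ≠ 0).image (· - 1)).card := by
  unfold pairDist hammingDist
  congr 1
  ext i
  have : (∃ j, w j ≠ 0 ∧ j - 1 = i) ↔ w (i + 1) ≠ 0 :=
    ⟨by rintro ⟨j, hj, rfl⟩; simpa using hj, fun h => ⟨i + 1, h, by simp⟩⟩
  simp only [pairRead_succ_apply, Finset.mem_filter, Finset.mem_univ, true_and, Finset.mem_union,
    Finset.mem_image, this]
  simp only [Pi.zero_apply, ne_eq, Prod.mk.injEq]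
  tauto

/-- A nonempty proper subset of `ℤ / (n + 1)` is not closed under `i ↦ i - 1`. -/
theorem card_lt_card_union_image_sub_one {n : ℕ} {T : Finset (Fin (n + 1))} (hT : T.Nonempty)
    (hT' : T.card < n + 1) : T.card < (T ∪ T.image (· - 1)).card := by
  refine Finset.card_lt_card ⟨Finset.subset_union_left, fun hsub => ?_⟩
  have hstep : ∀ i ∈ T, i - 1 ∈ T := fun i hi =>
    hsub (Finset.mem_union_right _ (Finset.mem_image_of_mem _ hi))
  obtain ⟨a, ha⟩ := hT
  have hall : ∀ m : Fin (n + 1), a - m ∈ T := by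
    intro m
    induction m using Fin.induction with
    | zero => simpa using ha
    | succ m ih =>
      have := hstep _ ih
      rwa [sub_sub, Fin.coeSucc_eq_succ] at this
  have huniv : T = Finset.univ := by
    refine Finset.eq_univ_iff_forall.2 fun i => ?_
    have := hall (a - i)
    rwa [sub_sub_cancel] at this
  rw [huniv, Finset.card_univ, Fintype.card_fin] at hT'
  exact lt_irrefl _ hT'

/-- A word whose support has `t` elements has pair-weight at least `min n (t + 1)`. -/
theorem le_pairDist_zero {n t d : ℕ} (hd : d ≤ n) (ht : d ≤ t + 1) (hd1 : 2 ≤ d) {R : Type*}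
    [DecidableEq R] [Zero R] {w : Fin n → R}
    (h : t ≤ (Finset.univ.filter fun i => w i ≠ 0).card) : d ≤ pairDist w 0 := by
  obtain ⟨n, rfl⟩ : ∃ n', n = n' + 1 := ⟨n - 1, by omega⟩
  rw [pairDist_zero_eq_card]
  set T := Finset.univ.filter fun i => w i ≠ 0
  rcases lt_or_ge T.card (n + 1) with hlt | hge
  · have := card_lt_card_union_image_sub_one (Finset.card_pos.1 (by omega)) hlt
    omega
  · exact (hd.trans hge).trans (Finset.card_le_card Finset.subset_union_left)

/-- A word of length at least four has pair-weight at least four unless its support lies in two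
cyclically adjacent positions. -/
theorem four_le_pairDist_zero {n : ℕ} (hn : 4 ≤ n) {R : Type*} [DecidableEq R] [Zero R]
    {w : Fin n → R} (hw : ∀ j, ∃ i, w i ≠ 0 ∧ i ≠ j ∧ i ≠ finRotate n j) :
    4 ≤ pairDist w 0 := by
  rcases le_or_gt 3 (Finset.univ.filter fun i => w i ≠ 0).card with h3 | h3
  · exact le_pairDist_zero hn (by omega) (by omega) h3
  obtain ⟨n, rfl⟩ : ∃ n', n = n' + 1 := ⟨n - 1, by omega⟩
  obtain ⟨a, ha, -⟩ := hw 0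
  obtain ⟨b, hb, hba, hba'⟩ := hw a
  obtain ⟨c, hc, hcb, hcb'⟩ := hw b
  rw [finRotate_apply] at hba' hcb'
  -- The support has at most two elements, so the witness avoiding `b` and `b + 1` is `a`.
  have hca : c = a := by
    by_contra hca
    have hsub : ({a, b, c} : Finset (Fin (n + 1))) ⊆ Finset.univ.filter fun i => w i ≠ 0 := by
      intro i hi
      simp only [Finset.mem_insert, Finset.mem_singleton] at hi
      rcases hi with rfl | rfl | rfl <;> simp [*]
    have := Finset.card_le_card hsub
    rw [Finset.card_eq_three.2 ⟨a, b, c, hba.symm, Ne.symm hca, hcb.symm, rfl⟩] at this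
    omega
  subst hca
  have hone : (1 : Fin (n + 1)) ≠ 0 := by
    rw [Ne, Fin.one_eq_zero_iff]
    omega
  rw [pairDist_zero_eq_card]
  have hsub : ({c, b, c - 1, b - 1} : Finset (Fin (n + 1))) ⊆
      (Finset.univ.filter fun i => w i ≠ 0) ∪
        (Finset.univ.filter fun i => w i ≠ 0).image (· - 1) := by
    intro i hi
    simp only [Finset.mem_insert, Finset.mem_singleton] at hi
    rcases hi with rfl | rfl | rfl | rfl
    · exact Finset.mem_union_left _ (by simp [*])
    · exact Finset.mem_union_left _ (by simp [*])
    · exact Finset.mem_union_right _ (Finset.mem_image_of_mem (· - 1) (by simp [*]))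
    · exact Finset.mem_union_right _ (Finset.mem_image_of_mem (· - 1) (by simp [*]))
  refine le_trans (le_of_eq ?_) (Finset.card_le_card hsub)
  have h1 : c ≠ c - 1 := fun h => hone (sub_eq_self.1 h.symm)
  have h2 : b ≠ b - 1 := fun h => hone (sub_eq_self.1 h.symm)
  have h3 : c ≠ b - 1 := fun h => hba' (by rw [h]; simp)
  have h4 : b ≠ c - 1 := fun h => hcb' (by rw [h]; simp)
  have h5 : c - 1 ≠ b - 1 := fun h => hba (sub_left_injective h).symm
  rw [Finset.card_insert_of_notMem (by simp [h1, h3, Ne.symm hba]),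
    Finset.card_insert_of_notMem (by simp [h2, h4]),
    Finset.card_insert_of_notMem (by simp [h5]), Finset.card_singleton]

theorem existsMDS_two {n : ℕ} (hn : 2 ≤ n) (q : ℕ) (hq : 2 ≤ q) :
    ExistsMDSSymbolPairCode n 2 q := by
  have : NeZero q := ⟨by omega⟩
  rw [← ZMod.card q] at hq ⊢
  refine existsMDS_of_check le_rfl hn hq (0 : (Fin n → ZMod q) →+ PUnit.{1})
    (fun _ => ⟨0, rfl⟩) (by simp) fun w _ hw => ?_
  obtain ⟨i, hi⟩ := Function.ne_iff.1 hw
  exact le_pairDist_zero (t := 1) hn le_rfl le_rfl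
    (Finset.card_pos.2 ⟨i, Finset.mem_filter.2 ⟨Finset.mem_univ i, hi⟩⟩)

theorem existsMDS_three {n : ℕ} (hn : 3 ≤ n) (q : ℕ) (hq : 2 ≤ q) :
    ExistsMDSSymbolPairCode n 3 q := by
  have : NeZero q := ⟨by omega⟩
  rw [← ZMod.card q] at hq ⊢
  let φ : (Fin n → ZMod q) →+ ZMod q := ∑ i, Pi.evalAddMonoidHom (fun _ => ZMod q) i
  have hφ : ∀ w, φ w = ∑ i, w i := fun w => by simp [φ]
  refine existsMDS_of_check (by norm_num) hn hq φ (fun a => ⟨Pi.single ⟨0, by omega⟩ a, ?_⟩)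
    (by simp) fun w hw hne => ?_
  · rw [hφ, Finset.sum_pi_single']
    simp
  obtain ⟨i, hi⟩ := Function.ne_iff.1 hne
  refine le_pairDist_zero (t := 2) hn le_rfl (by norm_num) ?_
  -- A second nonzero coordinate exists, since the coordinates sum to zero.
  obtain ⟨j, hji, hj⟩ : ∃ j, j ≠ i ∧ w j ≠ 0 := by
    by_contra! hall
    rw [hφ, Finset.sum_eq_single i (fun j _ hji => hall j hji) (by simp)] at hw
    exact hi hw
  refine Finset.one_lt_card.2 ⟨i, ?_, j, ?_, hji.symm⟩ <;> simp <;> assumption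

theorem existsMDS_four {n : ℕ} (hn : 4 ≤ n) (q : ℕ) (hq : 2 ≤ q) :
    ExistsMDSSymbolPairCode n 4 q := by
  have : NeZero q := ⟨by omega⟩
  rw [← ZMod.card q] at hq ⊢
  let φ : (Fin n → ZMod q) →+ ZMod q × ZMod q :=
    ∑ i, ((AddMonoidHom.mulLeft (altFst (ZMod q) n i)).prod
      (AddMonoidHom.mulLeft (altSnd (ZMod q) n i))).comp (Pi.evalAddMonoidHom (fun _ => ZMod q) i)
  have hφ : ∀ w, φ w = (∑ i, altFst (ZMod q) n i * w i, ∑ i, altSnd (ZMod q) n i * w i) := by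
    intro w
    ext <;> simp [φ, Prod.fst_sum, Prod.snd_sum]
  refine existsMDS_of_check (by norm_num) hn hq φ (fun a => ?_)
    (by simp [sq]) fun w hw hne => ?_
  · -- The first two check columns are `(1, 0)` and `(0, 1)`.
    refine ⟨Pi.single ⟨0, by omega⟩ a.1 + Pi.single ⟨1, by omega⟩ a.2, ?_⟩
    have h0 : ∀ k : ℕ, k < 2 → k + 1 ≠ n := fun k hk => by omega
    rw [hφ]
    simp only [Pi.add_apply, mul_add, Finset.sum_add_distrib, Pi.single_apply, mul_ite, mul_zero,
      Finset.sum_ite_eq', Finset.mem_univ, if_true]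
    simp [altFst, altSnd, h0]
  · refine four_le_pairDist_zero hn fun j => ?_
    by_contra! hall
    have hj : j ≠ finRotate n j := by
      rw [Ne, Fin.ext_iff, val_finRotate]
      split_ifs <;> omega
    have hsum : ∀ c : Fin n → ZMod q,
        ∑ i, c i * w i = c j * w j + c (finRotate n j) * w (finRotate n j) := by
      intro c
      refine Finset.sum_eq_add j _ hj (fun i _ hi => ?_) (by simp) (by simp)
      have : w i = 0 := by
        by_contra hwi
        exact hi.2 (hall i hwi hi.1)
      rw [this, mul_zero]
    rw [hφ, hsum, hsum, Prod.mk_eq_zero] at hw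
    obtain ⟨h1, h2⟩ := altFst_altSnd_columns (by omega) j hw.1 hw.2
    refine hne (funext fun i => ?_)
    by_contra hwi
    by_cases hij : i = j
    · exact hwi (hij ▸ h1)
    · exact hwi ((hall i hwi hij) ▸ h2)

/-! ### The octagon over a ring, and the existence part of `q(8, 7) = 3` -/

/-- Eight columns in `R ^ 3` such that any two distinct cyclically adjacent pairs of them span
`R ^ 3`, provided that `ω` and `ω - 1` are units. -/
def octagon {R : Type*} [CommRing R] (ω : R) : Matrix (Fin 8) (Fin 3) R :=
  !![1, 0, 0; 0, 1, 0; 0, 0, 1; -1, 0, ω; 1, 1, 0; 1, 1, -1; 1, 0, -1; 0, 1, -1]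

theorem octagon_spans {R : Type*} [CommRing R] {ω : R} (h₀ : IsUnit ω) (h₁ : IsUnit (ω - 1))
    {i j : Fin 8} (hij : i ≠ j) {x : Fin 3 → R}
    (hi : (octagon ω).mulVec x i = 0 ∧ (octagon ω).mulVec x (finRotate 8 i) = 0)
    (hj : (octagon ω).mulVec x j = 0 ∧ (octagon ω).mulVec x (finRotate 8 j) = 0) : x = 0 := by
  obtain ⟨u, hu⟩ := h₀.exists_left_inv
  obtain ⟨v, hv⟩ := h₁.exists_left_inv
  have key : x 0 = 0 ∧ x 1 = 0 ∧ x 2 = 0 := by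
    wlog hlt : i < j generalizing i j
    · exact this hij.symm hj hi (lt_of_le_of_ne (not_lt.1 hlt) hij.symm)
    fin_cases i <;> fin_cases j <;> first | exact absurd hlt (by decide) | skip
    all_goals
      simp [octagon, Matrix.mulVec, dotProduct, Fin.sum_univ_three] at hi hj
      obtain ⟨h1, h2⟩ := hi
      obtain ⟨h3, h4⟩ := hj
      grind
  funext a
  fin_cases a
  exacts [key.1, key.2.1, key.2.2]

theorem existsMDS_octagon {R : Type*} [CommRing R] [Fintype R] (hR : 2 ≤ Fintype.card R) {ω : R}
    (h₀ : IsUnit ω) (h₁ : IsUnit (ω - 1)) : ExistsMDSSymbolPairCode 8 7 (Fintype.card R) := by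
  refine existsMDS_of_generator (k := 3) (by norm_num) (by norm_num) rfl hR (octagon ω) ?_
  intro T hT x hx
  obtain ⟨i, j, hij, rfl⟩ := Finset.card_eq_two.1 (by omega : T.card = 2)
  exact octagon_spans h₀ h₁ hij (hx i (by simp)) (hx j (by simp))

/-- Eight columns in `F_2 ^ 3` for which any two distinct cyclically adjacent pairs span, except
that the pairs `0` and `3` vanish together on the vector `(0, 0, 1)`. -/
def binaryOctagon : Matrix (Fin 8) (Fin 3) (ZMod 2) :=
  !![1, 0, 0; 0, 1, 0; 0, 0, 1; 1, 0, 0; 0, 1, 0; 1, 0, 1; 1, 1, 0; 1, 1, 1]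

set_option synthInstance.maxHeartbeats 200000 in
set_option synthInstance.maxSize 1000 in
theorem binaryOctagon_collision : ∀ (e : Fin 3 → ZMod 2) (i j : Fin 8), e ≠ 0 → i < j →
    binaryOctagon.mulVec e i = 0 → binaryOctagon.mulVec e (finRotate 8 i) = 0 →
    binaryOctagon.mulVec e j = 0 → binaryOctagon.mulVec e (finRotate 8 j) = 0 →
    i = 0 ∧ j = 3 ∧ e 2 = 1 := by
  decide +kernel

/-- Encoder of the doubled code: the message is a pair of a message `x` for the octagon over `R`
and a message `b` for the binary octagon. The nonlinear indicator of `b 2 = 1`, added to the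
`R`-part of letter `4`, separates the words on which the binary octagon alone fails. -/
def doubledOctagon {R : Type*} [CommRing R] (ω : R) (m : (Fin 3 → R) × (Fin 3 → ZMod 2))
    (i : Fin 8) : R × ZMod 2 :=
  ((octagon ω).mulVec m.1 i + (if i = 4 ∧ m.2 2 = 1 then 1 else 0), binaryOctagon.mulVec m.2 i)

theorem existsMDS_doubledOctagon {R : Type*} [CommRing R] [Fintype R]
    (hR : 2 ≤ Fintype.card R) {ω : R} (h₀ : IsUnit ω) (h₁ : IsUnit (ω - 1)) :
    ExistsMDSSymbolPairCode 8 7 (2 * Fintype.card R) := by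
  classical
  have : Nontrivial R := Fintype.one_lt_card_iff_nontrivial.1 hR
  have hcard : 2 * Fintype.card R = Fintype.card (R × ZMod 2) := by
    rw [Fintype.card_prod, ZMod.card, mul_comm]
  rw [hcard]
  refine existsMDS_of_encoder (by norm_num) (by norm_num) (by omega) (doubledOctagon ω) ?_ ?_
  · simp only [Fintype.card_prod, Fintype.card_fun, Fintype.card_fin, ZMod.card]
    ring
  rintro ⟨x, b⟩ ⟨y, c⟩ hne
  by_contra hlt
  obtain ⟨T, hT, h⟩ := exists_agree_of_pairDist_lt (k := 3) (by norm_num) rfl (not_le.1 hlt)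
  obtain ⟨i, j, hij, rfl⟩ := Finset.card_eq_two.1 (by omega : T.card = 2)
  have hi := h i (by simp)
  have hj := h j (by simp)
  clear h hT
  wlog hlt' : i < j generalizing i j
  · exact this j i hij.symm hj hi (lt_of_le_of_ne (not_lt.1 hlt') hij.symm)
  simp only [doubledOctagon, Prod.mk.injEq] at hi hj
  obtain ⟨⟨hi1, hi2⟩, hi3, hi4⟩ := hi
  obtain ⟨⟨hj1, hj2⟩, hj3, hj4⟩ := hj
  by_cases hbc : b = c
  · subst hbc
    have hx : x - y = 0 := octagon_spans h₀ h₁ hij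
      (by simpa only [Matrix.mulVec_sub, Pi.sub_apply, sub_eq_zero] using
        ⟨add_right_cancel hi1, add_right_cancel hi3⟩)
      (by simpa only [Matrix.mulVec_sub, Pi.sub_apply, sub_eq_zero] using
        ⟨add_right_cancel hj1, add_right_cancel hj3⟩)
    exact hne (by rw [sub_eq_zero.1 hx])
  · obtain ⟨rfl, rfl, he⟩ := binaryOctagon_collision (b - c) i j (sub_ne_zero.2 hbc) hlt'
      (by rw [Matrix.mulVec_sub, Pi.sub_apply, hi2, sub_self])
      (by rw [Matrix.mulVec_sub, Pi.sub_apply, hi4, sub_self])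
      (by rw [Matrix.mulVec_sub, Pi.sub_apply, hj2, sub_self])
      (by rw [Matrix.mulVec_sub, Pi.sub_apply, hj4, sub_self])
    -- Letters `0`, `1`, `3` force `x = y`, and then letter `4` would equate `0` and `1`.
    have h1 : finRotate 8 (0 : Fin 8) = 1 := by decide
    have h4 : finRotate 8 (3 : Fin 8) = 4 := by decide
    have hbit : ∀ s t : ZMod 2, s - t = 1 → (s = 1 ∧ t ≠ 1) ∨ (s ≠ 1 ∧ t = 1) := by decide
    obtain ⟨u, hu⟩ := h₀.exists_left_inv
    rw [h1] at hi3
    rw [h4] at hj3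
    simp [octagon, Matrix.mulVec, dotProduct, Fin.sum_univ_three] at hi1 hi3 hj1 hj3
    have h2 : x 2 = y 2 := by grind
    have hone : (1 : R) ≠ 0 := one_ne_zero
    rcases hbit _ _ he with ⟨hb, hc⟩ | ⟨hb, hc⟩
    · simp [hb, hc, hi1, hi3] at hj3
    · simp [hb, hc, hi1, hi3] at hj3

/-- `q` is the size of a commutative ring with an element `ω` such that `ω` and `ω - 1` are
units; the zero ring is admitted. -/
def IsOctagonOrder (q : ℕ) : Prop :=
  ∃ (R : Type) (_ : CommRing R) (_ : Fintype R) (ω : R),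
    IsUnit ω ∧ IsUnit (ω - 1) ∧ Fintype.card R = q

theorem IsOctagonOrder.mul {q r : ℕ} (hq : IsOctagonOrder q) (hr : IsOctagonOrder r) :
    IsOctagonOrder (q * r) := by
  obtain ⟨R, _, _, ω, h₀, h₁, rfl⟩ := hq
  obtain ⟨R', _, _, ω', h₀', h₁', rfl⟩ := hr
  exact ⟨R × R', inferInstance, inferInstance, (ω, ω'), Prod.isUnit_iff.2 ⟨h₀, h₀'⟩,
    Prod.isUnit_iff.2 ⟨h₁, h₁'⟩, Fintype.card_prod R R'⟩

theorem isOctagonOrder_of_odd {q : ℕ} (hq : Odd q) : IsOctagonOrder q := by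
  have : NeZero q := ⟨hq.pos.ne'⟩
  refine ⟨ZMod q, inferInstance, inferInstance, 2, ?_, ?_, ZMod.card q⟩
  · exact (ZMod.isUnit_iff_coprime 2 q).2 (Nat.coprime_two_left.2 hq)
  · rw [show (2 : ZMod q) - 1 = 1 by ring]
    exact isUnit_one

theorem isOctagonOrder_four : IsOctagonOrder 4 := by
  classical
  let _ : Fintype (GaloisField 2 2) := Fintype.ofFinite _
  have hcard : Fintype.card (GaloisField 2 2) = 4 := by
    rw [← Nat.card_eq_fintype_card, GaloisField.card 2 2 (by norm_num)]
    norm_num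
  obtain ⟨ω, -, hω⟩ := Finset.exists_mem_notMem_of_card_lt_card
    (s := ({0, 1} : Finset (GaloisField 2 2))) (t := Finset.univ)
    (by rw [Finset.card_univ, hcard]; exact Finset.card_le_two.trans_lt (by norm_num))
  rw [Finset.mem_insert, Finset.mem_singleton, not_or] at hω
  exact ⟨GaloisField 2 2, inferInstance, inferInstance, ω, isUnit_iff_ne_zero.2 hω.1,
    isUnit_iff_ne_zero.2 (sub_ne_zero.2 hω.2), hcard⟩

theorem isOctagonOrder_or_double (q : ℕ) (hq : 0 < q) :
    IsOctagonOrder q ∨ ∃ r, q = 2 * r ∧ IsOctagonOrder r := by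
  induction q using Nat.strong_induction_on with
  | _ q ih =>
    rcases Nat.even_or_odd' q with ⟨r, rfl | rfl⟩
    · rcases Nat.even_or_odd' r with ⟨s, rfl | rfl⟩
      · rcases ih s (by omega) (by omega) with h | ⟨t, rfl, h⟩
        · left
          rw [← mul_assoc]
          exact isOctagonOrder_four.mul h
        · right
          exact ⟨4 * t, by ring, isOctagonOrder_four.mul h⟩
      · exact Or.inr ⟨_, rfl, isOctagonOrder_of_odd ⟨s, rfl⟩⟩
    · exact Or.inl (isOctagonOrder_of_odd ⟨r, rfl⟩)

theorem existsMDS_eight_seven (q : ℕ) (hq : 3 ≤ q) : ExistsMDSSymbolPairCode 8 7 q := by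
  rcases isOctagonOrder_or_double q (by omega) with h | ⟨r, rfl, h⟩
  · obtain ⟨R, _, _, ω, h₀, h₁, rfl⟩ := h
    exact existsMDS_octagon (by omega) h₀ h₁
  · obtain ⟨R, _, _, ω, h₀, h₁, rfl⟩ := h
    exact existsMDS_doubledOctagon (by omega) h₀ h₁

/-! ### No binary code for `(8, 7)` -/

/-- Double counting of the triples of two codewords and a read position at which they agree: each
of the `8` positions contributes at least `8 ^ 2 / 4 = 16` ordered pairs of codewords, whereas
distinct codewords agree at most once, so that there are at most `8 * 8 + 8 * 7` triples. -/
theorem not_existsMDS_eight_seven_two : ¬ ExistsMDSSymbolPairCode 8 7 2 := by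
  rintro ⟨C, ⟨-, hmin⟩, hcard⟩
  have hC : C.card = 8 := by simpa using hcard
  let N : ℕ := ∑ u ∈ C, ∑ v ∈ C, (Finset.univ.filter fun i => pairRead u i = pairRead v i).card
  have hupper : N ≤ 120 := by
    have hrow : ∀ u ∈ C,
        ∑ v ∈ C, (Finset.univ.filter fun i => pairRead u i = pairRead v i).card ≤ 15 := by
      intro u hu
      rw [← Finset.add_sum_erase C _ hu]
      have h1 : ∑ v ∈ C.erase u,
          (Finset.univ.filter fun i => pairRead u i = pairRead v i).card ≤ (C.erase u).card * 1 := by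
        refine Finset.sum_le_card_nsmul _ _ _ fun v hv => ?_
        have hv' := Finset.mem_erase.1 hv
        have := card_agree_add_pairDist u v
        have : 7 ≤ pairDist u v := hmin ⟨u, hu, v, hv'.2, hv'.1.symm, rfl⟩
        omega
      have h2 := card_agree_add_pairDist u u
      rw [Finset.card_erase_of_mem hu, hC] at h1
      omega
    calc N ≤ C.card * 15 := Finset.sum_le_card_nsmul _ _ _ hrow
      _ = 120 := by rw [hC]
  have hlower : 128 ≤ N := by
    have hN : N = ∑ i, ∑ u ∈ C, (C.filter fun v => pairRead u i = pairRead v i).card := by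
      simp only [N, Finset.card_filter]
      exact (Finset.sum_congr rfl fun u _ => Finset.sum_comm).trans Finset.sum_comm
    have hcol : ∀ i : Fin 8, 16 ≤ ∑ u ∈ C, (C.filter fun v => pairRead u i = pairRead v i).card := by
      intro i
      have h1 : ∑ u ∈ C, (C.filter fun v => pairRead u i = pairRead v i).card =
          ∑ s : Fin 2 × Fin 2, (C.filter fun v => pairRead v i = s).card ^ 2 := by
        rw [← Finset.sum_fiberwise C (fun u => pairRead u i)]
        refine Finset.sum_congr rfl fun s _ => ?_
        rw [Finset.sum_congr rfl (g := fun _ => (C.filter fun v => pairRead v i = s).card), sq,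
          Finset.sum_const, smul_eq_mul]
        intro u hu
        rw [← (Finset.mem_filter.1 hu).2]
        simp only [eq_comm]
      have h2 : ∑ s : Fin 2 × Fin 2, (C.filter fun v => pairRead v i = s).card = 8 := by
        refine Eq.trans ?_ hC
        exact (Finset.card_eq_sum_card_fiberwise fun _ _ => Finset.mem_univ _).symm
      have h3 := sq_sum_le_card_mul_sum_sq (s := (Finset.univ : Finset (Fin 2 × Fin 2)))
        (f := fun s => (C.filter fun v => pairRead v i = s).card)
      rw [h2, Finset.card_univ, Fintype.card_prod, Fintype.card_fin] at h3
      rw [h1]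
      simp only [Nat.cast_id] at h3
      omega
    rw [hN]
    calc 128 = Finset.card (Finset.univ : Finset (Fin 8)) • 16 := by simp
      _ ≤ _ := Finset.card_nsmul_le_sum _ _ _ fun i _ => hcol i
  omega

theorem mdsThresholdEq_eight_seven : MDSThresholdEq 8 7 3 := by
  refine ⟨existsMDS_eight_seven, fun q₀ hq₀ => ?_⟩
  by_contra hlt
  exact not_existsMDS_eight_seven_two (hq₀ 2 (by omega))

theorem mainTheorem1 :
    (∀ n d : ℕ, 2 ≤ d → d ≤ 4 → d ≤ n → MDSThresholdEq n d 2) ∧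
    (∀ n : ℕ, 2 ≤ n → MDSThresholdEq n n 2) ∧
    MDSThresholdEq 6 5 2 ∧
    MDSThresholdEq 7 6 2 ∧
    MDSThresholdEq 8 7 3 ∧
    (∀ n : ℕ, 7 ≤ n → n ≤ 10 → MDSThresholdEq n (n - 2) 2) := by
  refine ⟨fun n d hd hd4 hdn => ?_, fun n hn => mdsThresholdEq_two (existsMDS_self hn),
    mdsThresholdEq_two existsMDS_six_five, mdsThresholdEq_two existsMDS_seven_six,
    mdsThresholdEq_eight_seven, fun n hn hn10 => ?_⟩
  · interval_cases d
    · exact mdsThresholdEq_two (existsMDS_two hdn)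
    · exact mdsThresholdEq_two (existsMDS_three hdn)
    · exact mdsThresholdEq_two (existsMDS_four hdn)
  · interval_cases n
    · exact mdsThresholdEq_two existsMDS_seven_five
    · exact mdsThresholdEq_two existsMDS_eight_six
    · exact mdsThresholdEq_two existsMDS_nine_seven
    · exact mdsThresholdEq_two existsMDS_ten_eight
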